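/- For finite sets $A_1,\dots,A_k\subset\mathbb{R}$ let $$E_+(A_1,\dots,A_k)=\#\{(\mathbf a,\mathbf a')\in (A_1\times\cdots\times A_k)^2: a_1+\cdots+a_k=a_1'+\cdots+a_k'\},$$ $$E_\times(A_1,\dots,A_k)=\#\{(\mathbf a,\mathbf a')\in (A_1\times\cdots\times A_k)^2: a_1\cdots a_k=a_1'\cdots a_k'\},$$ and write $E_+^{(k)}(A)=E_+(A,\dots,A)$ and $E_\times^{(k)}(A)=E_\times(A,\dots,A)$, with $k$ copies of $A$. Theorem 1.4. Put $\delta=\frac{2}{33}$. There is an absolute constant $K>0$ such that the following holds. Let $A\subset\mathbb{R}$ be a finite set with $|A|\ge 2$, and let $m,n\ge 2$ be integers. Then there exist disjoint subsets $B$ and $C$ of $A$ with $A=B\cup C$, $$E_+^{(m)}(B)\le K|A|^{2m-1-\delta}(\log |A|)^{1-\delta}$$ and $$E_\times^{(n)}(C)\le K|A|^{2n-1-\delta}(\log |A|)^{1-\delta}.$$ -/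

import Mathlib

/-- The `k`-fold additive energy `E_+(A₁, …, A_k)`: the number of pairs `(a, a')` of elements of
`A₁ × ⋯ × A_k` with `a₁ + ⋯ + a_k = a'₁ + ⋯ + a'_k`. -/
noncomputable def multiAddEnergy {k : ℕ} (A : Fin k → Finset ℝ) : ℕ :=
  {p ∈ Fintype.piFinset A ×ˢ Fintype.piFinset A | ∑ i, p.1 i = ∑ i, p.2 i}.card

/-- The `k`-fold multiplicative energy `E_×(A₁, …, A_k)`: the number of pairs `(a, a')` of elements
of `A₁ × ⋯ × A_k` with `a₁ ⋯ a_k = a'₁ ⋯ a'_k`. -/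
noncomputable def multiMulEnergy {k : ℕ} (A : Fin k → Finset ℝ) : ℕ :=
  {p ∈ Fintype.piFinset A ×ˢ Fintype.piFinset A | ∏ i, p.1 i = ∏ i, p.2 i}.card

/-- `E_+^{(k)}(A) = E_+(A, …, A)`, with `k` copies of `A`. -/
noncomputable def foldAddEnergy (k : ℕ) (A : Finset ℝ) : ℕ :=
  multiAddEnergy (fun _ : Fin k => A)

/-- `E_×^{(k)}(A) = E_×(A, …, A)`, with `k` copies of `A`. -/
noncomputable def foldMulEnergy (k : ℕ) (A : Finset ℝ) : ℕ :=
  multiMulEnergy (fun _ : Fin k => A)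

/-! Write N = |A|. Fixing two first coordinates and applying Cauchy–Schwarz to the remaining ones
shows that each further summand or factor costs at most |B|², so the claim reduces to m = n = 2. For
products this needs 0 ∉ C, so a possible 0 is left in B.

For order two, let C be a largest subset of A with 0 ∉ C and E_×(C) ≤ c|C|⁴, where c is a constant
times N^(-35/33); then E_×(C) ≤ cN⁴, which is of order N^(3-2/33). If B = A \ C had additive energy
well above N^(3-2/33), it would contain a nonempty F with the same property
(`exists_subset_small_mulEnergy`). Since the fourth root of E_× is subadditive
(`mulEnergy_union_le`), C ∪ F would qualify too, contradicting maximality.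

To find F, Balog–Szemerédi–Gowers gives D ⊆ B with |D| ≫ |B|/Q and |D+D| ≪ Q⁶|D|, where Q is about
|B|³/E_+(B) up to a logarithm. A third of D has constant sign, and Solymosi's argument bounds its
multiplicative energy by |F+F|² times a logarithm. With |F| ≥ N/q and Q ≤ q this is at most of order
q¹⁴N⁻²|F|⁴, again up to a logarithm. Without logarithms this balances at saving 1/15; as 2/33 = 1/15
- 1/165, every logarithm is absorbed into N^(1/165), and the log factor in the theorem is only
needed to be bounded below. -/

namespace LowEnergy

open Finset
open scoped Pointwise

/-! ### Collisions -/

/-- The number of solutions of `f x = g y` as a sum of products of fibre sizes. -/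
theorem card_collisions_eq_sum {α β γ : Type*} [DecidableEq γ] (P : Finset α) (Q : Finset β)
    (T : Finset γ) (f : α → γ) (g : β → γ) (hf : ∀ x ∈ P, f x ∈ T) :
    #{x ∈ P ×ˢ Q | f x.1 = g x.2} = ∑ c ∈ T, #{x ∈ P | f x = c} * #{y ∈ Q | g y = c} := by
  rw [card_eq_sum_card_fiberwise (f := fun x => f x.1) (t := T)]
  · refine sum_congr rfl fun c _ => ?_
    rw [← card_product]
    congr 1
    ext ⟨x, y⟩
    simp only [mem_filter, mem_product]
    constructor
    · rintro ⟨⟨⟨h1, h2⟩, h3⟩, h4⟩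
      exact ⟨⟨h1, h4⟩, h2, by rw [← h3, h4]⟩
    · rintro ⟨⟨h1, h4⟩, h2, h3⟩
      exact ⟨⟨⟨h1, h2⟩, by rw [h3, h4]⟩, h4⟩
  · intro x hx
    simp only [coe_filter, mem_product, Set.mem_ofPred_eq] at hx
    exact hf _ hx.1.1

theorem card_collisions_sq_le {α β γ : Type*} [DecidableEq γ] (P : Finset α) (Q : Finset β)
    (f : α → γ) (g : β → γ) :
    #{x ∈ P ×ˢ Q | f x.1 = g x.2} ^ 2 ≤
      #{x ∈ P ×ˢ P | f x.1 = f x.2} * #{y ∈ Q ×ˢ Q | g y.1 = g y.2} := by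
  have hf : ∀ x ∈ P, f x ∈ P.image f ∪ Q.image g := fun x hx =>
    mem_union_left _ (mem_image_of_mem f hx)
  have hg : ∀ y ∈ Q, g y ∈ P.image f ∪ Q.image g := fun y hy =>
    mem_union_right _ (mem_image_of_mem g hy)
  rw [card_collisions_eq_sum P Q _ f g hf, card_collisions_eq_sum P P _ f f hf,
    card_collisions_eq_sum Q Q _ g g hg]
  simp only [← sq]
  exact sum_mul_sq_le_sq_mul_sq _ _ _

/-- Prepending a coordinate that acts injectively multiplies the number of collisions by at most
`|B| ^ 2`. -/
theorem card_collisions_cons_le {R : Type*} [DecidableEq R] {k : ℕ} (B : Finset R) (φ : R → R → R)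
    (hφ : ∀ b ∈ B, Function.Injective (φ b)) (v : (Fin k → R) → R) :
    #{p ∈ Fintype.piFinset (fun _ : Fin (k + 1) => B) ×ˢ
        Fintype.piFinset (fun _ : Fin (k + 1) => B) |
        φ (p.1 0) (v fun i => p.1 i.succ) = φ (p.2 0) (v fun i => p.2 i.succ)} ≤
      #B ^ 2 * #{p ∈ Fintype.piFinset (fun _ : Fin k => B) ×ˢ
        Fintype.piFinset (fun _ : Fin k => B) | v p.1 = v p.2} := by
  set P := Fintype.piFinset (fun _ : Fin k => B) with hP
  rw [card_eq_sum_card_fiberwise (f := fun p => (p.1 0, p.2 0)) (t := B ×ˢ B), sq, ← card_product,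
    ← smul_eq_mul]
  · refine sum_le_card_nsmul _ _ _ fun c hc => ?_
    obtain ⟨b, b'⟩ := c
    rw [mem_product] at hc
    have hself : ∀ b ∈ B, #{x ∈ P ×ˢ P | φ b (v x.1) = φ b (v x.2)} =
        #{x ∈ P ×ˢ P | v x.1 = v x.2} := fun b hb => by
      simp only [(hφ b hb).eq_iff]
    -- Cauchy–Schwarz decouples the two fixed first coordinates; injectivity then removes each of
    -- them.
    have h1 := card_collisions_sq_le P P (fun x => φ b (v x)) (fun x => φ b' (v x))
    rw [hself b hc.1, hself b' hc.2, ← sq] at h1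
    refine le_trans ?_ ((Nat.pow_le_pow_iff_left two_ne_zero).1 h1)
    refine card_le_card_of_injOn (fun p => (fun i => p.1 i.succ, fun i => p.2 i.succ)) ?_ ?_
    · rintro ⟨p, q⟩ hpq
      simp only [coe_filter, mem_filter, mem_product, Fintype.mem_piFinset, Prod.mk.injEq,
        Set.mem_ofPred_eq] at hpq
      obtain ⟨⟨⟨hp, hq⟩, h⟩, rfl, rfl⟩ := hpq
      simp only [coe_filter, mem_product, Set.mem_ofPred_eq, hP, Fintype.mem_piFinset]
      exact ⟨⟨fun i => hp _, fun i => hq _⟩, h⟩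
    · rintro ⟨p, q⟩ hpq ⟨p', q'⟩ hpq' h
      simp only [coe_filter, mem_filter, Prod.mk.injEq, Set.mem_ofPred_eq] at hpq hpq' h
      refine Prod.ext (funext fun i => ?_) (funext fun i => ?_)
      · refine Fin.cases ?_ (fun i => congrFun h.1 i) i
        exact hpq.2.1.trans hpq'.2.1.symm
      · refine Fin.cases ?_ (fun i => congrFun h.2 i) i
        exact hpq.2.2.trans hpq'.2.2.symm
  · rintro ⟨p, q⟩ hpq
    simp only [coe_filter, mem_product, Fintype.mem_piFinset, Set.mem_ofPred_eq] at hpq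
    simp only [coe_product, Set.mem_prod, mem_coe]
    exact ⟨hpq.1.1 _, hpq.1.2 _⟩

/-! ### Reduction of the `k`-fold energies to the usual ones -/

theorem card_pairs_fin_two {R : Type*} [DecidableEq R] (B : Finset R) (φ : R → R → R) :
    #{p ∈ Fintype.piFinset (fun _ : Fin 2 => B) ×ˢ Fintype.piFinset (fun _ : Fin 2 => B) |
        φ (p.1 0) (p.1 1) = φ (p.2 0) (p.2 1)} =
      #{x ∈ (B ×ˢ B) ×ˢ B ×ˢ B | φ x.1.1 x.1.2 = φ x.2.1 x.2.2} := by
  refine card_equiv ((finTwoArrowEquiv R).prodCongr (finTwoArrowEquiv R)) ?_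
  rintro ⟨p, q⟩
  simp [Fintype.mem_piFinset, Fin.forall_fin_two]

theorem foldAddEnergy_two (B : Finset ℝ) : foldAddEnergy 2 B = addEnergy B B := by
  rw [addEnergy_eq_card_filter, ← card_pairs_fin_two B (fun x y => x + y)]
  simp only [foldAddEnergy, multiAddEnergy, Fin.sum_univ_two]

theorem foldMulEnergy_two (B : Finset ℝ) : foldMulEnergy 2 B = mulEnergy B B := by
  rw [mulEnergy_eq_card_filter, ← card_pairs_fin_two B (fun x y => x * y)]
  simp only [foldMulEnergy, multiMulEnergy, Fin.prod_univ_two]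

theorem foldAddEnergy_le (B : Finset ℝ) (k : ℕ) :
    foldAddEnergy (k + 2) B ≤ #B ^ (2 * k) * addEnergy B B := by
  induction k with
  | zero => simp [foldAddEnergy_two]
  | succ k ih =>
    have h := card_collisions_cons_le (k := k + 2) B (fun x y => x + y)
      (fun b _ => add_right_injective b) (fun x => ∑ i, x i)
    calc foldAddEnergy (k + 1 + 2) B ≤ #B ^ 2 * foldAddEnergy (k + 2) B := by
          simp only [← Fin.sum_univ_succ] at h
          exact h
      _ ≤ #B ^ 2 * (#B ^ (2 * k) * addEnergy B B) := by gcongr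
      _ = _ := by ring

theorem foldMulEnergy_le (B : Finset ℝ) (hB : (0 : ℝ) ∉ B) (k : ℕ) :
    foldMulEnergy (k + 2) B ≤ #B ^ (2 * k) * mulEnergy B B := by
  induction k with
  | zero => simp [foldMulEnergy_two]
  | succ k ih =>
    have h := card_collisions_cons_le (k := k + 2) B (fun x y => x * y)
      (fun b hb => mul_right_injective₀ (ne_of_mem_of_not_mem hb hB)) (fun x => ∏ i, x i)
    calc foldMulEnergy (k + 1 + 2) B ≤ #B ^ 2 * foldMulEnergy (k + 2) B := by
          simp only [← Fin.prod_univ_succ] at h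
          exact h
      _ ≤ #B ^ 2 * (#B ^ (2 * k) * mulEnergy B B) := by gcongr
      _ = _ := by ring

/-! ### Dyadic pigeonholing -/

/-- Each nonzero `r i` lies within a factor 2 above some power of two, and there are `Nat.log 2 N +
1` scales; `t` is the scale contributing most. -/
theorem exists_level_set {ι : Type*} (s : Finset ι) (r : ι → ℕ) (N : ℕ) (hr : ∀ i ∈ s, r i ≤ N) :
    ∃ t : ℕ, 0 < t ∧ ∑ i ∈ s, r i ^ 2 ≤ 4 * (Nat.log 2 N + 1) * (t ^ 2 * #{i ∈ s | t ≤ r i}) := by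
  set n := Nat.log 2 N + 1 with hn
  obtain ⟨j, hj, hmax⟩ := exists_max_image (range n)
    (fun j => (2 ^ j) ^ 2 * #{i ∈ s | 2 ^ j ≤ r i}) ⟨0, by simp [hn]⟩
  refine ⟨2 ^ j, by positivity, ?_⟩
  calc ∑ i ∈ s, r i ^ 2
      ≤ ∑ i ∈ s, ∑ j ∈ range n, if 2 ^ j ≤ r i then 4 * (2 ^ j) ^ 2 else 0 := by
        refine sum_le_sum fun i hi => ?_
        rcases Nat.eq_zero_or_pos (r i) with h0 | h0
        · simp [h0]
        · have hmem : Nat.log 2 (r i) ∈ range n := by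
            rw [mem_range, hn, Nat.lt_succ_iff]
            exact Nat.log_mono_right (hr i hi)
          refine le_trans ?_ (single_le_sum (f := fun j => if 2 ^ j ≤ r i then 4 * (2 ^ j) ^ 2
            else 0) (fun _ _ => Nat.zero_le _) hmem)
          simp only [if_pos (Nat.pow_log_le_self 2 h0.ne')]
          have h1 : r i ≤ 2 * 2 ^ Nat.log 2 (r i) := by
            have := Nat.lt_pow_succ_log_self (b := 2) (by norm_num) (r i)
            rw [pow_succ] at this
            omega
          calc r i ^ 2 ≤ (2 * 2 ^ Nat.log 2 (r i)) ^ 2 := by gcongr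
            _ = _ := by ring
    _ = ∑ j ∈ range n, 4 * ((2 ^ j) ^ 2 * #{i ∈ s | 2 ^ j ≤ r i}) := by
        rw [sum_comm]
        refine sum_congr rfl fun j _ => ?_
        rw [← sum_filter, sum_const, smul_eq_mul]
        ring
    _ ≤ ∑ _j ∈ range n, 4 * ((2 ^ j) ^ 2 * #{i ∈ s | 2 ^ j ≤ r i}) := by
        refine sum_le_sum fun i hi => ?_
        exact Nat.mul_le_mul_left _ (hmax i hi)
    _ = _ := by
        rw [sum_const, card_range, smul_eq_mul]
        ring

/-! ### Subadditivity of the fourth root of the multiplicative energy -/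

theorem mulEnergy_self_eq_card_div (Z : Finset ℝ) (hZ : (0 : ℝ) ∉ Z) : mulEnergy Z Z =
    #{x ∈ (Z ×ˢ Z) ×ˢ Z ×ˢ Z | x.1.1 / x.1.2 = x.2.1 / x.2.2} := by
  refine card_equiv ((Equiv.refl _).prodCongr (Equiv.prodComm _ _)) fun x => ?_
  simp only [mem_filter, mem_product, Equiv.prodCongr_apply, Prod.map_fst, Prod.map_snd,
    Equiv.refl_apply, Equiv.prodComm_apply, Prod.fst_swap, Prod.snd_swap]
  refine ⟨fun h => ⟨⟨h.1.1, h.1.2.2, h.1.2.1⟩, ?_⟩, fun h => ⟨⟨h.1.1, h.1.2.2, h.1.2.1⟩, ?_⟩⟩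
  · rw [div_eq_div_iff (ne_of_mem_of_not_mem h.1.1.2 hZ) (ne_of_mem_of_not_mem h.1.2.1 hZ), h.2,
      mul_comm]
  · have := h.2
    rw [div_eq_div_iff (ne_of_mem_of_not_mem h.1.1.2 hZ) (ne_of_mem_of_not_mem h.1.2.2 hZ)] at this
    rw [this, mul_comm]

/-- Writing x₁y₁ = x₂y₂ as x₁/x₂ = y₂/y₁ separates the two sets, so Cauchy–Schwarz applies. -/
theorem mulEnergy_sq_le (X Y : Finset ℝ) (hX : (0 : ℝ) ∉ X) (hY : (0 : ℝ) ∉ Y) :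
    mulEnergy X Y ^ 2 ≤ mulEnergy X X * mulEnergy Y Y := by
  have hXY : mulEnergy X Y = #{x ∈ (X ×ˢ X) ×ˢ Y ×ˢ Y | x.1.1 / x.1.2 = x.2.2 / x.2.1} := by
    unfold mulEnergy
    congr 1
    refine filter_congr fun x hx => ?_
    simp only [mem_product] at hx
    rw [div_eq_div_iff (ne_of_mem_of_not_mem hx.1.2 hX) (ne_of_mem_of_not_mem hx.2.1 hY),
      mul_comm x.2.2]
  have hswap : #{y ∈ (Y ×ˢ Y) ×ˢ Y ×ˢ Y | y.1.2 / y.1.1 = y.2.2 / y.2.1} =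
      #{y ∈ (Y ×ˢ Y) ×ˢ Y ×ˢ Y | y.1.1 / y.1.2 = y.2.1 / y.2.2} := by
    refine card_equiv ((Equiv.prodComm _ _).prodCongr (Equiv.prodComm _ _)) fun x => ?_
    simp only [mem_filter, mem_product, Equiv.prodCongr_apply, Prod.map_fst, Prod.map_snd,
      Equiv.prodComm_apply, Prod.fst_swap, Prod.snd_swap]
    tauto
  rw [hXY, mulEnergy_self_eq_card_div X hX, mulEnergy_self_eq_card_div Y hY, ← hswap]
  exact card_collisions_sq_le (X ×ˢ X) (Y ×ˢ Y) (fun x => x.1 / x.2) (fun y => y.2 / y.1)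

theorem mulEnergy_eq_sum_of_subset (X Y : Finset ℝ) (T : Finset ℝ)
    (hT : ∀ x ∈ X, ∀ y ∈ Y, x * y ∈ T) :
    mulEnergy X Y = ∑ c ∈ T, #{x ∈ X ×ˢ Y | x.1 * x.2 = c} ^ 2 := by
  rw [mulEnergy_eq_card_filter, card_collisions_eq_sum (X ×ˢ Y) (X ×ˢ Y) T (fun x => x.1 * x.2)
    (fun x => x.1 * x.2)]
  · simp only [sq]
  · intro x hx
    rw [mem_product] at hx
    exact hT _ hx.1 _ hx.2

/-- The representation function of the union is at most f + 2g + h, from the products XX, XY and YY.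
Cauchy–Schwarz with weights x², 2xy, y² (total (x + y)²) then behaves like the triangle inequality
for an L⁴ norm. -/
theorem mulEnergy_union_le (X Y : Finset ℝ) (hX : (0 : ℝ) ∉ X) (hY : (0 : ℝ) ∉ Y) (x y : ℝ)
    (hx : 0 < x) (hy : 0 < y) (hXx : (mulEnergy X X : ℝ) ≤ x ^ 4)
    (hYy : (mulEnergy Y Y : ℝ) ≤ y ^ 4) :
    (mulEnergy (X ∪ Y) (X ∪ Y) : ℝ) ≤ (x + y) ^ 4 := by
  set T : Finset ℝ := ((X ∪ Y) ×ˢ (X ∪ Y)).image fun p => p.1 * p.2 with hTdef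
  have hT : ∀ a ∈ X ∪ Y, ∀ b ∈ X ∪ Y, a * b ∈ T := fun a ha b hb =>
    mem_image.2 ⟨(a, b), mem_product.2 ⟨ha, hb⟩, rfl⟩
  have hl : X ⊆ X ∪ Y := subset_union_left
  have hr : Y ⊆ X ∪ Y := subset_union_right
  have hXYe : (mulEnergy X Y : ℝ) ≤ x ^ 2 * y ^ 2 := by
    have h := mulEnergy_sq_le X Y hX hY
    have h' : (mulEnergy X Y : ℝ) ^ 2 ≤ mulEnergy X X * mulEnergy Y Y := by exact_mod_cast h
    refine (pow_le_pow_iff_left₀ (by positivity) (by positivity) two_ne_zero).1 ?_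
    calc (mulEnergy X Y : ℝ) ^ 2 ≤ mulEnergy X X * mulEnergy Y Y := h'
      _ ≤ x ^ 4 * y ^ 4 := by gcongr
      _ = _ := by ring
  rw [mulEnergy_eq_sum_of_subset X X T fun a ha b hb => hT a (hl ha) b (hl hb)] at hXx
  rw [mulEnergy_eq_sum_of_subset Y Y T fun a ha b hb => hT a (hr ha) b (hr hb)] at hYy
  rw [mulEnergy_eq_sum_of_subset X Y T fun a ha b hb => hT a (hl ha) b (hr hb)] at hXYe
  rw [mulEnergy_eq_sum_of_subset (X ∪ Y) (X ∪ Y) T hT]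
  set f : ℝ → ℕ := fun c => #{p ∈ X ×ˢ X | p.1 * p.2 = c}
  set g : ℝ → ℕ := fun c => #{p ∈ X ×ˢ Y | p.1 * p.2 = c}
  set h : ℝ → ℕ := fun c => #{p ∈ Y ×ˢ Y | p.1 * p.2 = c}
  have hle : ∀ c, #{p ∈ (X ∪ Y) ×ˢ (X ∪ Y) | p.1 * p.2 = c} ≤ f c + 2 * g c + h c := fun c => by
    have hg' : #{p ∈ Y ×ˢ X | p.1 * p.2 = c} = g c := by
      refine card_equiv (Equiv.prodComm _ _) fun p => ?_
      simp only [mem_filter, mem_product, Equiv.prodComm_apply, Prod.fst_swap, Prod.snd_swap,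
        mul_comm p.2]
      tauto
    have hsub : {p ∈ (X ∪ Y) ×ˢ (X ∪ Y) | p.1 * p.2 = c} ⊆
        ({p ∈ X ×ˢ X | p.1 * p.2 = c} ∪ {p ∈ X ×ˢ Y | p.1 * p.2 = c}) ∪
        ({p ∈ Y ×ˢ X | p.1 * p.2 = c} ∪ {p ∈ Y ×ˢ Y | p.1 * p.2 = c}) := by
      intro p
      simp only [mem_filter, mem_product, mem_union]
      tauto
    have h1 := card_le_card hsub
    have h2 := card_union_le ({p ∈ X ×ˢ X | p.1 * p.2 = c} ∪ {p ∈ X ×ˢ Y | p.1 * p.2 = c})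
      ({p ∈ Y ×ˢ X | p.1 * p.2 = c} ∪ {p ∈ Y ×ˢ Y | p.1 * p.2 = c})
    have h3 := card_union_le {p ∈ X ×ˢ X | p.1 * p.2 = c} {p ∈ X ×ˢ Y | p.1 * p.2 = c}
    have h4 := card_union_le {p ∈ Y ×ˢ X | p.1 * p.2 = c} {p ∈ Y ×ˢ Y | p.1 * p.2 = c}
    simp only [f, g, h] at hg' ⊢
    omega
  push_cast at hXx hYy hXYe ⊢
  have key : ∀ a b c : ℝ, (a + 2 * b + c) ^ 2 ≤
      (x + y) ^ 2 * (a ^ 2 / x ^ 2 + 2 * (b ^ 2 / (x * y)) + c ^ 2 / y ^ 2) := fun a b c => by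
    have hid : (x + y) ^ 2 * (a ^ 2 / x ^ 2 + 2 * (b ^ 2 / (x * y)) + c ^ 2 / y ^ 2) -
        (a + 2 * b + c) ^ 2 =
        2 * (a * y - b * x) ^ 2 / (x * y) + (a * y ^ 2 - c * x ^ 2) ^ 2 / (x ^ 2 * y ^ 2) +
          2 * (b * y - c * x) ^ 2 / (x * y) := by
      field_simp
      ring
    have : 0 ≤ 2 * (a * y - b * x) ^ 2 / (x * y) + (a * y ^ 2 - c * x ^ 2) ^ 2 / (x ^ 2 * y ^ 2) +
          2 * (b * y - c * x) ^ 2 / (x * y) := by positivity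
    linarith
  calc ∑ c ∈ T, (#{p ∈ (X ∪ Y) ×ˢ (X ∪ Y) | p.1 * p.2 = c} : ℝ) ^ 2
      ≤ ∑ c ∈ T, (x + y) ^ 2 * ((f c : ℝ) ^ 2 / x ^ 2 + 2 * ((g c : ℝ) ^ 2 / (x * y)) +
        (h c : ℝ) ^ 2 / y ^ 2) := by
        refine sum_le_sum fun c _ => le_trans ?_ (key _ _ _)
        have : (#{p ∈ (X ∪ Y) ×ˢ (X ∪ Y) | p.1 * p.2 = c} : ℝ) ≤ f c + 2 * g c + h c := by
          exact_mod_cast hle c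
        gcongr
    _ = (x + y) ^ 2 * ((∑ c ∈ T, (f c : ℝ) ^ 2) / x ^ 2 +
          2 * ((∑ c ∈ T, (g c : ℝ) ^ 2) / (x * y)) + (∑ c ∈ T, (h c : ℝ) ^ 2) / y ^ 2) := by
        rw [← mul_sum, sum_add_distrib, sum_add_distrib, ← sum_div, ← sum_div, ← mul_sum, ← sum_div]
    _ ≤ (x + y) ^ 2 * (x ^ 4 / x ^ 2 + 2 * (x ^ 2 * y ^ 2 / (x * y)) + y ^ 4 / y ^ 2) := by
        gcongr
    _ = (x + y) ^ 4 := by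
        field_simp
        ring

/-! ### Solymosi's inequality -/

/-- Adding points on consecutive rich lines through the origin produces distinct points of
`(D + D) × (D + D)`. -/
theorem card_sub_one_mul_sq_le (D : Finset ℝ) (hD : ∀ x ∈ D, 0 < x) (Λ : Finset ℝ) (t : ℕ)
    (ht : ∀ l ∈ Λ, t ≤ #{p ∈ D ×ˢ D | p.1 / p.2 = l}) :
    (#Λ - 1) * t ^ 2 ≤ #(D + D) ^ 2 := by
  obtain h0 | ⟨k, hk⟩ : #Λ = 0 ∨ ∃ k, #Λ = k + 1 := by
    cases h : #Λ with
    | zero => exact Or.inl rfl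
    | succ k => exact Or.inr ⟨k, rfl⟩
  · simp [h0]
  set f := Λ.orderEmbOfFin hk with hf
  have hfm : ∀ i, f i ∈ Λ := fun i => Λ.orderEmbOfFin_mem hk i
  set R : ℝ → Finset (ℝ × ℝ) := fun l => {p ∈ D ×ˢ D | p.1 / p.2 = l} with hR
  have hmem : ∀ l (p : ℝ × ℝ), p ∈ R l → p.1 ∈ D ∧ p.2 ∈ D ∧ 0 < p.2 ∧ p.1 = l * p.2 := by
    intro l p hp
    simp only [hR, mem_filter, mem_product] at hp
    have h2 := hD _ hp.1.2
    exact ⟨hp.1.1, hp.1.2, h2, by rw [← hp.2, div_mul_cancel₀ _ h2.ne']⟩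
  set W : Finset (Σ _ : Fin k, (ℝ × ℝ) × (ℝ × ℝ)) :=
    univ.sigma fun i => R (f i.castSucc) ×ˢ R (f i.succ) with hW
  have hWcard : k * t ^ 2 ≤ #W := by
    rw [hW, card_sigma]
    calc k * t ^ 2 = ∑ _i : Fin k, t ^ 2 := by simp
      _ ≤ _ := sum_le_sum fun i _ => by
        rw [card_product, sq]
        exact Nat.mul_le_mul (ht _ (hfm _)) (ht _ (hfm _))
  rw [hk, Nat.add_sub_cancel]
  refine hWcard.trans ?_
  rw [sq, ← card_product]
  have hWm : ∀ w ∈ W, (w.2.1 ∈ R (f w.1.castSucc) ∧ w.2.2 ∈ R (f w.1.succ)) := by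
    intro w hw
    simpa [hW] using hw
  refine card_le_card_of_injOn (fun w => (w.2.1.1 + w.2.2.1, w.2.1.2 + w.2.2.2)) ?_ ?_
  · intro w hw
    obtain ⟨h1, h2⟩ := hWm w hw
    obtain ⟨a1, a2, -, -⟩ := hmem _ _ h1
    obtain ⟨b1, b2, -, -⟩ := hmem _ _ h2
    exact mem_coe.2 (mem_product.2 ⟨add_mem_add a1 b1, add_mem_add a2 b2⟩)
  -- A sum of points on two consecutive lines lies strictly between them, so it determines the
  -- index; linear independence of the two directions then determines both points.
  · have hslope : ∀ w ∈ W, f w.1.castSucc * (w.2.1.2 + w.2.2.2) < w.2.1.1 + w.2.2.1 ∧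
        w.2.1.1 + w.2.2.1 < f w.1.succ * (w.2.1.2 + w.2.2.2) ∧ 0 < w.2.1.2 + w.2.2.2 := by
      intro w hw
      obtain ⟨h1, h2⟩ := hWm w hw
      obtain ⟨-, -, a3, a4⟩ := hmem _ _ h1
      obtain ⟨-, -, b3, b4⟩ := hmem _ _ h2
      have hlt : f w.1.castSucc < f w.1.succ := f.strictMono Fin.castSucc_lt_succ
      rw [a4, b4]
      refine ⟨?_, ?_, by positivity⟩
      · nlinarith [mul_pos (sub_pos.2 hlt) b3]
      · nlinarith [mul_pos (sub_pos.2 hlt) a3]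
    have hle : ∀ w ∈ W, ∀ w' ∈ W, (w.2.1.1 + w.2.2.1, w.2.1.2 + w.2.2.2) =
        (w'.2.1.1 + w'.2.2.1, w'.2.1.2 + w'.2.2.2) → w.1 ≤ w'.1 := by
      intro w hw w' hw' h
      rw [Prod.mk.injEq] at h
      obtain ⟨s1, -, s3⟩ := hslope w hw
      obtain ⟨-, s2, -⟩ := hslope w' hw'
      rw [h.1, h.2] at s1
      rw [h.2] at s3
      have h3 : f w.1.castSucc < f w'.1.succ := lt_of_mul_lt_mul_right (s1.trans s2) s3.le
      have h4 := f.lt_iff_lt.1 h3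
      exact Fin.castSucc_lt_succ_iff.1 h4
    rintro ⟨i, p, q⟩ hw ⟨j, p', q'⟩ hw' h
    obtain rfl : i = j := le_antisymm (hle _ hw _ hw' h) (hle _ hw' _ hw h.symm)
    obtain ⟨h1, h2⟩ := hWm _ hw
    obtain ⟨h1', h2'⟩ := hWm _ hw'
    obtain ⟨-, -, -, a⟩ := hmem _ _ h1
    obtain ⟨-, -, -, b⟩ := hmem _ _ h2
    obtain ⟨-, -, -, a'⟩ := hmem _ _ h1'
    obtain ⟨-, -, -, b'⟩ := hmem _ _ h2'
    simp only [Prod.mk.injEq] at h a b a' b'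
    have hlt : f i.castSucc < f i.succ := f.strictMono Fin.castSucc_lt_succ
    have hmul : (f i.succ - f i.castSucc) * (q.2 - q'.2) = 0 := by
      have h5 := h.1
      rw [a, b, a', b'] at h5
      linear_combination h5 - f i.castSucc * h.2
    have hq : q.2 = q'.2 := by
      rcases mul_eq_zero.1 hmul with h0 | h0
      · exact absurd h0 (sub_pos.2 hlt).ne'
      · linarith
    have hp : p.2 = p'.2 := by linarith [h.2]
    have hp1 : p = p' := Prod.ext (by rw [a, a', hp]) hp
    have hq1 : q = q' := Prod.ext (by rw [b, b', hq]) hq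
    rw [hp1, hq1]

/-- Solymosi's bound for the multiplicative energy in terms of the sumset. -/
theorem mulEnergy_le_card_add_sq (D : Finset ℝ) (hD : ∀ x ∈ D, 0 < x) :
    mulEnergy D D ≤ 8 * (Nat.log 2 #D + 1) * #(D + D) ^ 2 := by
  rcases D.eq_empty_or_nonempty with rfl | hne
  · simp
  have h0 : (0 : ℝ) ∉ D := fun h => lt_irrefl _ (hD 0 h)
  set T := (D ×ˢ D).image fun p => p.1 / p.2
  have hr : ∀ l ∈ T, #{p ∈ D ×ˢ D | p.1 / p.2 = l} ≤ #D := by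
    intro l _
    refine card_le_card_of_injOn Prod.snd ?_ ?_
    · intro p hp
      simp only [coe_filter, mem_product, Set.mem_ofPred_eq] at hp
      exact hp.1.2
    · rintro ⟨a, b⟩ hp ⟨a', b'⟩ hp' h
      simp only [coe_filter, mem_product, Set.mem_ofPred_eq] at hp hp' h
      subst h
      have hb := (hD _ hp.1.2).ne'
      have := hp.2.trans hp'.2.symm
      rw [div_left_inj' hb] at this
      rw [this]
  obtain ⟨t, -, ht⟩ := exists_level_set T (fun l => #{p ∈ D ×ˢ D | p.1 / p.2 = l}) #D hr
  rw [mulEnergy_self_eq_card_div D h0, card_collisions_eq_sum (D ×ˢ D) (D ×ˢ D) T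
    (fun p => p.1 / p.2) (fun p => p.1 / p.2) fun p hp => mem_image_of_mem _ hp]
  simp only [← sq]
  refine ht.trans ?_
  set Λ := {l ∈ T | t ≤ #{p ∈ D ×ˢ D | p.1 / p.2 = l}} with hΛ
  have h1 := card_sub_one_mul_sq_le D hD Λ t fun l hl => (mem_filter.1 hl).2
  have h2 : t ^ 2 * #Λ ≤ 2 * #(D + D) ^ 2 := by
    rcases Λ.eq_empty_or_nonempty with he | ⟨l, hl⟩
    · simp [he]
    -- There is one fewer consecutive pair than lines; the missing t² is paid for by t ≤ |D| ≤ |D +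
    -- D|.
    · have htD : t ≤ #(D + D) :=
        ((mem_filter.1 hl).2.trans (hr l (mem_filter.1 hl).1)).trans (card_le_card_add_left hne)
      have hpos : #Λ = #Λ - 1 + 1 := (Nat.sub_add_cancel (card_pos.2 ⟨l, hl⟩)).symm
      have htD2 : t ^ 2 ≤ #(D + D) ^ 2 := by gcongr
      calc t ^ 2 * #Λ = (#Λ - 1) * t ^ 2 + t ^ 2 := by
            conv_lhs => rw [hpos]
            ring
        _ ≤ _ := by omega
  calc 4 * (Nat.log 2 #D + 1) * (t ^ 2 * #Λ)
      ≤ 4 * (Nat.log 2 #D + 1) * (2 * #(D + D) ^ 2) := by gcongr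
    _ = _ := by ring

/-! ### Paths in dense bipartite graphs -/

theorem sum_card_neighbors_right {α β : Type*} (A : Finset α) (B : Finset β) (G : α → β → Prop)
    [∀ a b, Decidable (G a b)] :
    ∑ b ∈ B, #{x ∈ A | G x b} = #{p ∈ A ×ˢ B | G p.1 p.2} := by
  simp only [card_filter]
  rw [sum_product_right]

theorem sum_card_neighbors_left {α β : Type*} (A : Finset α) (B : Finset β) (G : α → β → Prop)
    [∀ a b, Decidable (G a b)] :
    ∑ x ∈ A, #{b ∈ B | G x b} = #{p ∈ A ×ˢ B | G p.1 p.2} := by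
  simp only [card_filter]
  rw [sum_product]

/-- In a dense bipartite graph some neighbourhood is large and almost all pairs of its elements
have many common neighbours. -/
theorem exists_neighborhood {α β : Type*} (A : Finset α) (B : Finset β) (G : α → β → Prop)
    [∀ a b, Decidable (G a b)] (a n ε : ℝ) (ha : 0 < a) (hε : 0 < ε) (hn : #A ≤ n)
    (hB : B.Nonempty) (he : a * n * #B ≤ #{p ∈ A ×ˢ B | G p.1 p.2}) :
    ∃ X ⊆ A, a ^ 2 * n ^ 2 / 2 ≤ (#X : ℝ) ^ 2 ∧
      (#{p ∈ X ×ˢ X | (#{b ∈ B | G p.1 b ∧ G p.2 b} : ℝ) < ε / 2 * a ^ 2 * #B} : ℝ) ≤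
        ε * (#X : ℝ) ^ 2 := by
  have hm : (0 : ℝ) < #B := by exact_mod_cast hB.card_pos
  have hn0 : 0 ≤ n := le_trans (Nat.cast_nonneg _) hn
  set θ : ℝ := ε / 2 * a ^ 2 * #B with hθ
  set X : β → Finset α := fun b => {x ∈ A | G x b} with hX
  set bad : β → ℕ := fun b =>
    #{p ∈ X b ×ˢ X b | (#{b ∈ B | G p.1 b ∧ G p.2 b} : ℝ) < θ} with hbad
  set Bad : Finset (α × α) := {p ∈ A ×ˢ A | (#{b ∈ B | G p.1 b ∧ G p.2 b} : ℝ) < θ} with hBad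
  have h1 : ∑ b ∈ B, bad b = ∑ p ∈ Bad, #{b ∈ B | G p.1 b ∧ G p.2 b} := by
    rw [sum_card_neighbors_left Bad B fun p b => G p.1 b ∧ G p.2 b,
      ← sum_card_neighbors_right Bad B fun p b => G p.1 b ∧ G p.2 b]
    refine sum_congr rfl fun b _ => ?_
    simp only [hbad]
    congr 1
    ext p
    simp only [hX, hBad, mem_filter, mem_product]
    tauto
  have h2 : (∑ b ∈ B, bad b : ℝ) ≤ n ^ 2 * θ := by
    have : (∑ b ∈ B, bad b : ℝ) = ∑ p ∈ Bad, (#{b ∈ B | G p.1 b ∧ G p.2 b} : ℝ) := by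
      exact_mod_cast h1
    rw [this]
    calc ∑ p ∈ Bad, (#{b ∈ B | G p.1 b ∧ G p.2 b} : ℝ) ≤ ∑ _p ∈ Bad, θ :=
          sum_le_sum fun p hp => (mem_filter.1 hp).2.le
      _ = #Bad * θ := by rw [sum_const, nsmul_eq_mul]
      _ ≤ n ^ 2 * θ := by
        have h3 : #Bad ≤ #A ^ 2 := by
          rw [sq, ← card_product]
          exact card_filter_le _ _
        have h4 : (#Bad : ℝ) ≤ (#A : ℝ) ^ 2 := by exact_mod_cast h3
        have h5 : 0 ≤ θ := by positivity
        refine mul_le_mul_of_nonneg_right (h4.trans ?_) h5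
        gcongr
  have h3 : a ^ 2 * n ^ 2 * #B ≤ ∑ b ∈ B, (#(X b) : ℝ) ^ 2 := by
    have hs : (∑ b ∈ B, (#(X b) : ℝ)) = #{p ∈ A ×ˢ B | G p.1 p.2} := by
      exact_mod_cast sum_card_neighbors_right A B G
    have hcs := sq_sum_le_card_mul_sum_sq (s := B) (f := fun b => (#(X b) : ℝ))
    have h4 : (a * n * #B) ^ 2 ≤ (∑ b ∈ B, (#(X b) : ℝ)) ^ 2 := by
      rw [hs]
      gcongr
    refine le_of_mul_le_mul_left ?_ hm
    calc (#B : ℝ) * (a ^ 2 * n ^ 2 * #B) = (a * n * #B) ^ 2 := by ring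
      _ ≤ _ := h4.trans hcs
  -- Dependent random choice: average |X b|² - bad b / ε over b. The squares are large by
  -- Cauchy–Schwarz, and a bad pair lies in fewer than θ neighbourhoods.
  obtain ⟨b, -, hb⟩ := exists_le_of_sum_le (s := B) (f := fun _ => a ^ 2 * n ^ 2 / 2)
    (g := fun b => (#(X b) : ℝ) ^ 2 - bad b / ε) hB (by
      rw [sum_const, nsmul_eq_mul, sum_sub_distrib, ← sum_div]
      have h4 : (∑ b ∈ B, bad b : ℝ) / ε ≤ a ^ 2 * n ^ 2 * #B / 2 := by
        rw [div_le_iff₀ hε]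
        refine h2.trans_eq ?_
        rw [hθ]
        ring
      linarith)
  refine ⟨X b, filter_subset _ _, ?_, ?_⟩
  · have : (0 : ℝ) ≤ bad b / ε := by positivity
    linarith
  · have h4 : (bad b : ℝ) / ε ≤ (#(X b) : ℝ) ^ 2 := by
      have : 0 ≤ a ^ 2 * n ^ 2 / 2 := by positivity
      linarith
    rw [div_le_iff₀ hε] at h4
    linarith

/-- A bipartite graph of density `a` contains large sets of vertices such that any two of them on
different sides are joined by many paths of length three. -/
theorem exists_paths_three {α β : Type*} (A : Finset α) (B : Finset β) (G : α → β → Prop)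
    [∀ a b, Decidable (G a b)] (a : ℝ) (ha : 0 < a) (hA : A.Nonempty) (hB : B.Nonempty)
    (he : a * #A * #B ≤ #{p ∈ A ×ˢ B | G p.1 p.2}) :
    ∃ X ⊆ A, ∃ Y ⊆ B, a * #A / 8 ≤ #X ∧ a * #B / 4 ≤ #Y ∧ ∀ x ∈ X, ∀ y ∈ Y,
      a ^ 5 * #A * #B / 2 ^ 12 ≤
        #{p ∈ A ×ˢ B | G x p.2 ∧ G p.1 p.2 ∧ G p.1 y} := by
  have hn : (0 : ℝ) < #A := by exact_mod_cast hA.card_pos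
  have hm : (0 : ℝ) < #B := by exact_mod_cast hB.card_pos
  -- Discarding vertices of low degree costs at most half the edges and guarantees that every
  -- remaining vertex has degree at least a/2 · |B|, which makes Y large later.
  set A₁ : Finset α := {x ∈ A | a / 2 * #B ≤ #{b ∈ B | G x b}} with hA₁
  have he₁ : a / 2 * #A * #B ≤ #{p ∈ A₁ ×ˢ B | G p.1 p.2} := by
    have hs : (∑ x ∈ A, (#{b ∈ B | G x b} : ℝ)) = #{p ∈ A ×ˢ B | G p.1 p.2} := by
      exact_mod_cast sum_card_neighbors_left A B G
    have hs₁ : (∑ x ∈ A₁, (#{b ∈ B | G x b} : ℝ)) = #{p ∈ A₁ ×ˢ B | G p.1 p.2} := by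
      exact_mod_cast sum_card_neighbors_left A₁ B G
    have hsplit := sum_filter_add_sum_filter_not A (fun x => a / 2 * #B ≤ (#{b ∈ B | G x b} : ℝ))
      (fun x => (#{b ∈ B | G x b} : ℝ))
    have hlow : ∑ x ∈ A with ¬ (a / 2 * #B ≤ (#{b ∈ B | G x b} : ℝ)), (#{b ∈ B | G x b} : ℝ) ≤
        #A * (a / 2 * #B) := by
      calc _ ≤ ∑ x ∈ A with ¬ (a / 2 * #B ≤ (#{b ∈ B | G x b} : ℝ)), a / 2 * (#B : ℝ) :=
            sum_le_sum fun x hx => (not_le.1 (mem_filter.1 hx).2).le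
        _ ≤ ∑ x ∈ A, a / 2 * (#B : ℝ) :=
            sum_le_sum_of_subset_of_nonneg (filter_subset _ _) fun _ _ _ => by positivity
        _ = _ := by rw [sum_const, nsmul_eq_mul]
    rw [← hs₁]
    rw [hs] at hsplit
    have : a / 2 * #A * #B = a * #A * #B - #A * (a / 2 * #B) := by ring
    linarith
  -- The size parameter stays |A|, not |A₁|, so the density is still a/2.
  obtain ⟨V, hVA, hVcard, hVbad⟩ := exists_neighborhood A₁ B G (a / 2) #A (a / 16) (by positivity)
    (by positivity) (by exact_mod_cast card_filter_le _ _) hB he₁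
  set θ : ℝ := a / 16 / 2 * (a / 2) ^ 2 * #B with hθ
  have hV : a * #A / 4 ≤ (#V : ℝ) := by
    refine (pow_le_pow_iff_left₀ (by positivity) (by positivity) two_ne_zero).1 ?_
    refine le_trans ?_ hVcard
    have : 0 ≤ a ^ 2 * (#A : ℝ) ^ 2 := by positivity
    nlinarith
  have hV0 : (0 : ℝ) < #V := lt_of_lt_of_le (by positivity) hV
  set bad : α → Finset α := fun x =>
    {x' ∈ V | (#{b ∈ B | G x b ∧ G x' b} : ℝ) < θ} with hbad
  set X : Finset α := {x ∈ V | (#(bad x) : ℝ) ≤ a / 8 * #V} with hX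
  set Y : Finset β := {y ∈ B | a / 4 * #V ≤ #{x ∈ V | G x y}} with hY
  refine ⟨X, (filter_subset _ _).trans (hVA.trans (filter_subset _ _)), Y, filter_subset _ _,
    ?_, ?_, ?_⟩
  · have hsum : (∑ x ∈ V, (#(bad x) : ℝ)) ≤ a / 16 * (#V : ℝ) ^ 2 := by
      refine le_trans (le_of_eq ?_) hVbad
      exact_mod_cast sum_card_neighbors_left V V fun x x' => (#{b ∈ B | G x b ∧ G x' b} : ℝ) < θ
    have hlow : (#{x ∈ V | ¬ (#(bad x) : ℝ) ≤ a / 8 * #V} : ℝ) * (a / 8 * #V) ≤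
        a / 16 * (#V : ℝ) ^ 2 := by
      calc _ = ∑ x ∈ V with ¬ (#(bad x) : ℝ) ≤ a / 8 * #V, a / 8 * (#V : ℝ) := by
            rw [sum_const, nsmul_eq_mul]
        _ ≤ ∑ x ∈ V with ¬ (#(bad x) : ℝ) ≤ a / 8 * #V, (#(bad x) : ℝ) :=
            sum_le_sum fun x hx => (not_le.1 (mem_filter.1 hx).2).le
        _ ≤ ∑ x ∈ V, (#(bad x) : ℝ) :=
            sum_le_sum_of_subset_of_nonneg (filter_subset _ _) fun _ _ _ => by positivity
        _ ≤ _ := hsum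
    have hsplit : (#X : ℝ) + #{x ∈ V | ¬ (#(bad x) : ℝ) ≤ a / 8 * #V} = #V := by
      exact_mod_cast card_filter_add_card_filter_not (s := V)
        fun x => (#(bad x) : ℝ) ≤ a / 8 * #V
    have hhalf : (#{x ∈ V | ¬ (#(bad x) : ℝ) ≤ a / 8 * #V} : ℝ) ≤ #V / 2 := by
      refine le_of_mul_le_mul_right ?_ (show 0 < a / 8 * (#V : ℝ) by positivity)
      refine hlow.trans_eq ?_
      ring
    linarith
  · have hsum : a / 2 * #B * #V ≤ ∑ y ∈ B, (#{x ∈ V | G x y} : ℝ) := by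
      have hs : (∑ y ∈ B, (#{x ∈ V | G x y} : ℝ)) = ∑ x ∈ V, (#{b ∈ B | G x b} : ℝ) := by
        exact_mod_cast (sum_card_neighbors_right V B G).trans (sum_card_neighbors_left V B G).symm
      rw [hs]
      calc a / 2 * #B * #V = ∑ _x ∈ V, a / 2 * (#B : ℝ) := by
            rw [sum_const, nsmul_eq_mul]
            ring
        _ ≤ _ := sum_le_sum fun x hx => (mem_filter.1 (hVA hx)).2
    have hup : ∑ y ∈ B, (#{x ∈ V | G x y} : ℝ) ≤ #Y * #V + #B * (a / 4 * #V) := by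
      rw [← sum_filter_add_sum_filter_not B (fun y => a / 4 * #V ≤ (#{x ∈ V | G x y} : ℝ))]
      refine add_le_add ?_ ?_
      · calc _ ≤ ∑ _y ∈ Y, (#V : ℝ) := sum_le_sum fun y _ => by
              exact_mod_cast card_filter_le _ _
          _ = _ := by rw [sum_const, nsmul_eq_mul]
      · calc _ ≤ ∑ y ∈ B with ¬ (a / 4 * #V ≤ (#{x ∈ V | G x y} : ℝ)), a / 4 * (#V : ℝ) :=
              sum_le_sum fun x hx => (not_le.1 (mem_filter.1 hx).2).le
          _ ≤ ∑ y ∈ B, a / 4 * (#V : ℝ) :=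
              sum_le_sum_of_subset_of_nonneg (filter_subset _ _) fun _ _ _ => by positivity
          _ = _ := by rw [sum_const, nsmul_eq_mul]
    refine le_of_mul_le_mul_right ?_ hV0
    linarith
  · intro x hx y hy
    have hxb := (mem_filter.1 hx).2
    have hyb := (mem_filter.1 hy).2
    -- Of the at least a/4 · |V| neighbours of y in V, at most a/8 · |V| are bad for x; each other
    -- x' gives θ paths x – b – x' – y.
    set U : Finset α := {x' ∈ V | G x' y ∧ θ ≤ #{b ∈ B | G x b ∧ G x' b}} with hU
    have hUcard : a / 8 * #V ≤ (#U : ℝ) := by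
      classical
      have hsub : {x' ∈ V | G x' y} ⊆ U ∪ bad x := by
        intro x' hx'
        simp only [hU, hbad, mem_union, mem_filter] at hx' ⊢
        rcases le_or_gt θ (#{b ∈ B | G x b ∧ G x' b} : ℝ) with h | h
        · exact Or.inl ⟨hx'.1, hx'.2, h⟩
        · exact Or.inr ⟨hx'.1, h⟩
      have h1 : (#{x' ∈ V | G x' y} : ℝ) ≤ #U + #(bad x) := by
        exact_mod_cast (card_le_card hsub).trans (card_union_le _ _)
      linarith
    have hpaths : ∑ x' ∈ U, #{b ∈ B | G x b ∧ G x' b} ≤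
        #{p ∈ A ×ˢ B | G x p.2 ∧ G p.1 p.2 ∧ G p.1 y} := by
      rw [sum_card_neighbors_left U B fun x' b => G x b ∧ G x' b]
      refine card_le_card fun p hp => ?_
      simp only [hU, mem_filter, mem_product] at hp ⊢
      exact ⟨⟨filter_subset _ _ (hVA hp.1.1.1), hp.1.2⟩, hp.2.1, hp.2.2, hp.1.1.2.1⟩
    calc a ^ 5 * #A * #B / 2 ^ 12 = a / 8 * (a * #A / 4) * θ := by
          rw [hθ]
          ring
      _ ≤ a / 8 * #V * θ := by gcongr
      _ ≤ #U * θ := by gcongr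
      _ = ∑ x' ∈ U, θ := by rw [sum_const, nsmul_eq_mul]
      _ ≤ ∑ x' ∈ U, (#{b ∈ B | G x b ∧ G x' b} : ℝ) :=
          sum_le_sum fun x' hx' => (mem_filter.1 hx').2.2
      _ ≤ _ := by exact_mod_cast hpaths

/-! ### A Balog–Szemerédi–Gowers theorem -/

/-- If any sum of `X + Y` comes from `m` paths of length three of the graph `x + y ∈ S`, then
`|X + Y| m ≤ |S| ^ 3`. -/
theorem card_add_mul_le_of_paths {R : Type*} [AddCommGroup R] [DecidableEq R] (A X Y S : Finset R)
    (m : ℝ) (h : ∀ x ∈ X, ∀ y ∈ Y,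
      m ≤ #{p ∈ A ×ˢ A | x + p.2 ∈ S ∧ p.1 + p.2 ∈ S ∧ p.1 + y ∈ S}) :
    #(X + Y) * m ≤ (#S : ℝ) ^ 3 := by
  have hfib : ∀ c ∈ X + Y, m ≤ #{s ∈ S ×ˢ S ×ˢ S | s.1 - s.2.1 + s.2.2 = c} := by
    intro c hc
    obtain ⟨x, hx, y, hy, rfl⟩ := mem_add.1 hc
    refine (h x hx y hy).trans ?_
    -- A path x – b – x' – y writes x + y = (x + b) - (x' + b) + (x' + y), and the three sums
    -- recover b and x'.
    refine Nat.cast_le.2 (card_le_card_of_injOn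
      (fun p => (x + p.2, p.1 + p.2, p.1 + y)) ?_ ?_)
    · intro p hp
      simp only [coe_filter, mem_product, Set.mem_ofPred_eq] at hp ⊢
      exact ⟨hp.2, by abel⟩
    · intro p _ q _ hpq
      simp only [Prod.mk.injEq, add_right_inj, add_left_inj] at hpq
      exact Prod.ext hpq.2.2 hpq.1
  calc #(X + Y) * m = ∑ _c ∈ X + Y, m := by rw [sum_const, nsmul_eq_mul]
    _ ≤ ∑ c ∈ X + Y, (#{s ∈ S ×ˢ S ×ˢ S | s.1 - s.2.1 + s.2.2 = c} : ℝ) := sum_le_sum hfib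
    _ ≤ (#(S ×ˢ S ×ˢ S) : ℝ) := by
        rw [← Nat.cast_sum, Nat.cast_le, sum_card_fiberwise_eq_card_filter]
        exact card_filter_le _ _
    _ = (#S : ℝ) ^ 3 := by
        rw [card_product, card_product]
        push_cast
        ring

/-- A set of large additive energy contains a large subset of small doubling. -/
theorem exists_subset_small_doubling {R : Type*} [AddCommGroup R] [DecidableEq R] (A : Finset R)
    (hA : A.Nonempty) :
    ∃ Q : ℝ, 0 < Q ∧ Q * addEnergy A A ≤ 4 * (Nat.log 2 #A + 1 : ℕ) * (#A : ℝ) ^ 3 ∧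
      ∃ D ⊆ A, (#A : ℝ) ≤ 8 * Q * #D ∧ (#(D + D) : ℝ) ≤ 2 ^ 29 * Q ^ 6 * #D := by
  have hr : ∀ c ∈ A + A, #{x ∈ A ×ˢ A | x.1 + x.2 = c} ≤ #A := by
    intro c _
    refine card_le_card_of_injOn Prod.fst ?_ ?_
    · intro p hp
      simp only [coe_filter, mem_product, Set.mem_ofPred_eq] at hp
      exact hp.1.1
    · rintro ⟨x, y⟩ hp ⟨x', y'⟩ hp' h
      simp only [coe_filter, mem_product, Set.mem_ofPred_eq] at hp hp' h
      subst h
      rw [add_left_cancel (hp.2.trans hp'.2.symm)]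
  obtain ⟨t, ht0, ht⟩ := exists_level_set (A + A) (fun c => #{x ∈ A ×ˢ A | x.1 + x.2 = c}) #A hr
  rw [← addEnergy_eq_sum_sq'] at ht
  set S := {c ∈ A + A | t ≤ #{x ∈ A ×ˢ A | x.1 + x.2 = c}} with hS
  have hS0 : S.Nonempty := by
    rw [nonempty_iff_ne_empty]
    intro h0
    rw [h0, card_empty, mul_zero, mul_zero] at ht
    exact absurd (addEnergy_self_pos hA) (not_lt.2 ht)
  have htA : t ≤ #A := by
    obtain ⟨c, hc⟩ := hS0
    exact (mem_filter.1 hc).2.trans (hr c (mem_filter.1 hc).1)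
  have hedge : t * #S ≤ #{p ∈ A ×ˢ A | p.1 + p.2 ∈ S} := by
    rw [← sum_card_fiberwise_eq_card_filter]
    calc t * #S = ∑ _c ∈ S, t := by rw [sum_const, smul_eq_mul, mul_comm]
      _ ≤ _ := sum_le_sum fun c hc => (mem_filter.1 hc).2
  have hNpos : (0 : ℝ) < #A := by exact_mod_cast hA.card_pos
  have hspos : (0 : ℝ) < #S := by exact_mod_cast hS0.card_pos
  have htpos : (0 : ℝ) < t := by exact_mod_cast ht0
  have htN : (t : ℝ) ≤ #A := by exact_mod_cast htA
  have hedge' : (t : ℝ) * #S ≤ #{p ∈ A ×ˢ A | p.1 + p.2 ∈ S} := by exact_mod_cast hedge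
  have ht' : (addEnergy A A : ℝ) ≤ 4 * (Nat.log 2 #A + 1 : ℕ) * ((t : ℝ) ^ 2 * #S) := by
    exact_mod_cast ht
  set N := (#A : ℝ)
  set s := (#S : ℝ)
  set u := (t : ℝ)
  -- Edge density of the graph of popular sums. Below, Q = N³ / (u²s), so that the energy is about
  -- N³/Q; the power Q⁶ is a⁻¹² rewritten using s.
  set a : ℝ := u * s / N ^ 2 with ha
  have ha0 : 0 < a := by positivity
  obtain ⟨X, hXA, Y, -, hX, hY, hpath⟩ := exists_paths_three A A (fun x y => x + y ∈ S) a ha0 hA hA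
    (by
      change a * N * N ≤ _
      refine le_trans (le_of_eq ?_) hedge'
      rw [ha]
      field_simp)
  have hXY := card_add_mul_le_of_paths A X Y S _ hpath
  have hruzsa : (#(X + X) : ℝ) * #Y ≤ #(X + Y) * #(X + Y) := by
    have := ruzsa_triangle_inequality_add_add_add X Y X
    rw [add_comm Y X] at this
    exact_mod_cast this
  refine ⟨N ^ 3 / (u ^ 2 * s), by positivity, ?_, X, hXA, ?_, ?_⟩
  · rw [div_mul_eq_mul_div, div_le_iff₀ (by positivity)]
    calc N ^ 3 * (addEnergy A A : ℝ) ≤ N ^ 3 * (4 * (Nat.log 2 #A + 1 : ℕ) * (u ^ 2 * s)) := by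
          gcongr
      _ = _ := by ring
  · calc N ≤ N * (N / u) := by
          refine le_mul_of_one_le_right hNpos.le ?_
          rwa [one_le_div htpos]
      _ = 8 * (N ^ 3 / (u ^ 2 * s)) * (a * N / 8) := by
          rw [ha]
          field_simp
      _ ≤ _ := by gcongr
  · have hYpos : 0 < a * N / 4 := by positivity
    have hsum : (#(X + Y) : ℝ) ≤ 2 ^ 12 * s ^ 3 / (a ^ 5 * N ^ 2) := by
      rw [le_div_iff₀ (by positivity)]
      have h1 : (#(X + Y) : ℝ) * (a ^ 5 * N ^ 2) =
          2 ^ 12 * (#(X + Y) * (a ^ 5 * N * N / 2 ^ 12)) := by ring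
      rw [h1]
      gcongr
    refine le_of_mul_le_mul_right ?_ hYpos
    calc (#(X + X) : ℝ) * (a * N / 4) ≤ #(X + X) * #Y := by gcongr
      _ ≤ #(X + Y) * #(X + Y) := hruzsa
      _ ≤ (2 ^ 12 * s ^ 3 / (a ^ 5 * N ^ 2)) * (2 ^ 12 * s ^ 3 / (a ^ 5 * N ^ 2)) := by gcongr
      _ = 2 ^ 29 * (N ^ 3 / (u ^ 2 * s)) ^ 6 * (a * N / 8) * (a * N / 4) := by
          rw [ha]
          field_simp
          norm_num
      _ ≤ _ := by gcongr

/-! ### The decomposition -/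

/-- The larger sign class has at least (|D| - 1)/2 elements, which is at least |D|/3 once |D| ≥ 3.
-/
theorem exists_subset_of_constant_sign (D : Finset ℝ) (hD : 3 ≤ #D) :
    ∃ F ⊆ D, #D ≤ 3 * #F ∧ ((∀ x ∈ F, 0 < x) ∨ ∀ x ∈ F, x < 0) := by
  have hsub : D ⊆ ({x ∈ D | 0 < x} ∪ {x ∈ D | x < 0}) ∪ {0} := by
    intro x hx
    simp only [mem_union, mem_filter, mem_singleton]
    rcases lt_trichotomy 0 x with h | h | h
    · exact Or.inl (Or.inl ⟨hx, h⟩)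
    · exact Or.inr h.symm
    · exact Or.inl (Or.inr ⟨hx, h⟩)
  have h1 := card_le_card hsub
  have h2 := card_union_le ({x ∈ D | 0 < x} ∪ {x ∈ D | x < 0}) {0}
  have h3 := card_union_le {x ∈ D | 0 < x} {x ∈ D | x < 0}
  rw [card_singleton] at h2
  rcases le_total #{x ∈ D | 0 < x} #{x ∈ D | x < 0} with h | h
  · exact ⟨{x ∈ D | x < 0}, filter_subset _ _, by omega, Or.inr fun x hx => (mem_filter.1 hx).2⟩
  · exact ⟨{x ∈ D | 0 < x}, filter_subset _ _, by omega, Or.inl fun x hx => (mem_filter.1 hx).2⟩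

theorem mulEnergy_le_card_add_sq_of_constant_sign (D : Finset ℝ)
    (hD : (∀ x ∈ D, 0 < x) ∨ ∀ x ∈ D, x < 0) :
    mulEnergy D D ≤ 8 * (Nat.log 2 #D + 1) * #(D + D) ^ 2 := by
  rcases hD with hD | hD
  · exact mulEnergy_le_card_add_sq D hD
  · have h := mulEnergy_le_card_add_sq (-D) fun x hx => by
      have := hD _ (mem_neg'.1 hx)
      linarith
    have hadd : -D + -D = -(D + D) := (neg_add D D).symm
    rw [hadd, card_neg, card_neg] at h
    refine le_trans ?_ h
    refine card_le_card_of_injOn (fun x => ((-x.1.1, -x.1.2), (-x.2.1, -x.2.2))) ?_ ?_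
    · intro x hx
      simpa [and_assoc] using hx
    · rintro ⟨⟨a, b⟩, c, d⟩ _ ⟨⟨a', b'⟩, c', d'⟩ _ h
      simpa using h

/-- 331 = 2 · 165 + 1, from log n ≤ 165 n^(1/165) and log 2 ≥ 1/2. -/
theorem natLog_add_one_le (n : ℕ) (hn : 1 ≤ n) :
    ((Nat.log 2 n + 1 : ℕ) : ℝ) ≤ 331 * (n : ℝ) ^ (1 / 165 : ℝ) := by
  have hn1 : (1 : ℝ) ≤ n := by exact_mod_cast hn
  have h1 : (1 : ℝ) ≤ (n : ℝ) ^ (1 / 165 : ℝ) := Real.one_le_rpow hn1 (by norm_num)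
  have h2 : Real.log n ≤ (n : ℝ) ^ (1 / 165 : ℝ) / (1 / 165) :=
    Real.log_le_rpow_div (by positivity) (by norm_num)
  have h3 : (Nat.log 2 n : ℝ) * Real.log 2 ≤ Real.log n := by
    rw [← Real.log_pow]
    refine Real.log_le_log (by positivity) ?_
    exact_mod_cast Nat.pow_log_le_self 2 (by omega)
  have h4 : (1 / 2 : ℝ) ≤ Real.log 2 := by linarith [Real.log_two_gt_d9]
  have h5 : (Nat.log 2 n : ℝ) * (1 / 2) ≤ Nat.log 2 n * Real.log 2 := by gcongr
  push_cast
  linarith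

/-- A set of large additive energy contains a nonempty subset of small multiplicative energy. -/
theorem exists_subset_small_mulEnergy (B : Finset ℝ) (N : ℕ) (hN : 1 ≤ N) (hB : #B ≤ N)
    (hE : 31776 * (N : ℝ) ^ (3 - 2 / 33 : ℝ) < addEnergy B B) :
    ∃ F ⊆ B, F.Nonempty ∧ (0 : ℝ) ∉ F ∧
      (mulEnergy F F : ℝ) ≤ 331 * 2 ^ 65 * (N : ℝ) ^ (-35 / 33 : ℝ) * (#F : ℝ) ^ 4 := by
  have hN1 : (1 : ℝ) ≤ N := by exact_mod_cast hN
  have hN0 : (0 : ℝ) < N := by linarith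
  have hBN : (#B : ℝ) ≤ N := by exact_mod_cast hB
  have hEpos : (0 : ℝ) < addEnergy B B := lt_of_le_of_lt (by positivity) hE
  have hBne : B.Nonempty := by
    rw [← addEnergy_self_pos_iff]
    exact_mod_cast hEpos
  have hB0 : (0 : ℝ) < #B := by exact_mod_cast hBne.card_pos
  have hlog : ∀ k ≤ N, ((Nat.log 2 k + 1 : ℕ) : ℝ) ≤ 331 * (N : ℝ) ^ (1 / 165 : ℝ) := by
    intro k hk
    refine le_trans ?_ (natLog_add_one_le N hN)
    exact_mod_cast Nat.succ_le_succ (Nat.log_mono_right hk)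
  obtain ⟨Q, hQ, hQE, D, hDB, hD, hDD⟩ := exists_subset_small_doubling B hBne
  -- 1/15 = 2/33 + 1/165: the energy saving plus the cost of one logarithm.
  set q : ℝ := (N : ℝ) ^ (1 / 15 : ℝ) with hq
  have hq0 : 0 < q := by positivity
  -- Keeping |B|³ on the right makes |D| large relative to N, not merely to |B|. Here 24 = 8 · 3
  -- (density loss, sign class) and 31776 = 24 · 4 · 331.
  have hQB : 24 * (Q * (N : ℝ) ^ 3) ≤ q * (#B : ℝ) ^ 3 := by
    have h1 : Q * (31776 * (N : ℝ) ^ (3 - 2 / 33 : ℝ)) ≤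
        4 * (331 * (N : ℝ) ^ (1 / 165 : ℝ)) * (#B : ℝ) ^ 3 := by
      refine le_trans (by gcongr) (hQE.trans ?_)
      gcongr
      exact hlog _ hB
    have h2 : (N : ℝ) ^ 3 = (N : ℝ) ^ (3 - 2 / 33 : ℝ) * (N : ℝ) ^ (2 / 33 : ℝ) := by
      rw [← Real.rpow_add hN0, ← Real.rpow_natCast]
      norm_num
    have h3 : q = (N : ℝ) ^ (1 / 165 : ℝ) * (N : ℝ) ^ (2 / 33 : ℝ) := by
      rw [hq, ← Real.rpow_add hN0]
      norm_num
    have h4 : (0 : ℝ) < (N : ℝ) ^ (2 / 33 : ℝ) := by positivity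
    rw [h2, h3]
    nlinarith [mul_le_mul_of_nonneg_right h1 h4.le]
  have hQq : 24 * Q ≤ q := by
    refine le_of_mul_le_mul_right ?_ (show (0 : ℝ) < (N : ℝ) ^ 3 by positivity)
    calc 24 * Q * (N : ℝ) ^ 3 ≤ q * (#B : ℝ) ^ 3 := by linarith
      _ ≤ q * (N : ℝ) ^ 3 := by gcongr
  have hDq : 3 * (N : ℝ) ≤ q * #D := by
    have h1 : 24 * (Q * (N : ℝ)) ≤ q * #B := by
      refine le_of_mul_le_mul_right ?_ (show (0 : ℝ) < (N : ℝ) ^ 2 by positivity)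
      calc 24 * (Q * (N : ℝ)) * (N : ℝ) ^ 2 = 24 * (Q * (N : ℝ) ^ 3) := by ring
        _ ≤ q * (#B : ℝ) ^ 3 := hQB
        _ = q * #B * (#B : ℝ) ^ 2 := by ring
        _ ≤ q * #B * (N : ℝ) ^ 2 := by gcongr
    refine le_of_mul_le_mul_left ?_ (show (0 : ℝ) < 8 * Q by positivity)
    calc 8 * Q * (3 * (N : ℝ)) = 24 * (Q * (N : ℝ)) := by ring
      _ ≤ q * #B := h1
      _ ≤ q * (8 * Q * #D) := by gcongr
      _ = _ := by ring
  have hqN : q ≤ N := by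
    rw [hq]
    calc (N : ℝ) ^ (1 / 15 : ℝ) ≤ (N : ℝ) ^ (1 : ℝ) :=
          Real.rpow_le_rpow_of_exponent_le hN1 (by norm_num)
      _ = N := Real.rpow_one _
  have hD3 : 3 ≤ #D := by
    have : (3 : ℝ) ≤ #D := by
      refine le_of_mul_le_mul_left ?_ hq0
      linarith
    exact_mod_cast this
  obtain ⟨F, hFD, hFcard, hF⟩ := exists_subset_of_constant_sign D hD3
  have hFcard' : (#D : ℝ) ≤ 3 * #F := by exact_mod_cast hFcard
  have hFN : (N : ℝ) ≤ q * #F := by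
    have : q * #D ≤ q * (3 * #F) := by gcongr
    linarith
  have hFF : (#(F + F) : ℝ) ≤ 2 ^ 31 * q ^ 6 * #F := by
    calc (#(F + F) : ℝ) ≤ #(D + D) := by exact_mod_cast card_le_card (add_subset_add hFD hFD)
      _ ≤ 2 ^ 29 * Q ^ 6 * #D := hDD
      _ ≤ 2 ^ 29 * q ^ 6 * (3 * #F) := by
          gcongr
          linarith
      _ ≤ _ := by
          have : 0 ≤ q ^ 6 * (#F : ℝ) := by positivity
          nlinarith
  refine ⟨F, hFD.trans hDB, card_pos.1 (by omega), ?_, ?_⟩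
  · intro h0
    rcases hF with h | h
    · exact lt_irrefl _ (h 0 h0)
    · exact lt_irrefl _ (h 0 h0)
  have hsol : (mulEnergy F F : ℝ) ≤ 8 * (Nat.log 2 #F + 1 : ℕ) * (#(F + F) : ℝ) ^ 2 := by
    exact_mod_cast mulEnergy_le_card_add_sq_of_constant_sign F hF
  have hFle : #F ≤ N := (card_le_card (hFD.trans hDB)).trans hB
  -- Two factors N ≤ q|F| turn |F|² into |F|⁴; the exponent is 1/165 + 14/15 - 2 = -35/33.
  calc (mulEnergy F F : ℝ) ≤ 8 * (Nat.log 2 #F + 1 : ℕ) * (#(F + F) : ℝ) ^ 2 := hsol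
    _ ≤ 8 * (331 * (N : ℝ) ^ (1 / 165 : ℝ)) * (2 ^ 31 * q ^ 6 * #F) ^ 2 := by
        gcongr
        exact hlog _ hFle
    _ = 331 * 2 ^ 65 * ((N : ℝ) ^ (1 / 165 : ℝ) * q ^ 12 * (N : ℝ) ^ (-2 : ℝ)) * (#F : ℝ) ^ 2 *
        (N : ℝ) ^ 2 := by
        rw [Real.rpow_neg hN0.le, Real.rpow_two]
        field_simp
        norm_num
    _ ≤ 331 * 2 ^ 65 * ((N : ℝ) ^ (1 / 165 : ℝ) * q ^ 12 * (N : ℝ) ^ (-2 : ℝ)) * (#F : ℝ) ^ 2 *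
        (q * #F) ^ 2 := by gcongr
    _ = 331 * 2 ^ 65 * ((N : ℝ) ^ (1 / 165 : ℝ) * q ^ 14 * (N : ℝ) ^ (-2 : ℝ)) *
        (#F : ℝ) ^ 4 := by ring
    _ = _ := by
        congr 2
        rw [hq, ← Real.rpow_natCast, ← Real.rpow_mul hN0.le, ← Real.rpow_add hN0,
          ← Real.rpow_add hN0]
        norm_num

/-- The low-energy decomposition for the energies of order two. -/
theorem exists_low_energy_decomposition (A : Finset ℝ) (hA : A.Nonempty) :
    ∃ C ⊆ A, (0 : ℝ) ∉ C ∧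
      (addEnergy (A \ C) (A \ C) : ℝ) ≤ 31776 * (#A : ℝ) ^ (3 - 2 / 33 : ℝ) ∧
      (mulEnergy C C : ℝ) ≤ 331 * 2 ^ 65 * (#A : ℝ) ^ (3 - 2 / 33 : ℝ) := by
  have hN0 : (0 : ℝ) < #A := by exact_mod_cast hA.card_pos
  set c : ℝ := 331 * 2 ^ 65 * (#A : ℝ) ^ (-35 / 33 : ℝ) with hc
  have hc0 : 0 < c := by positivity
  set κ : ℝ := c ^ (1 / 4 : ℝ) with hκ
  have hκ0 : 0 < κ := by positivity
  have hκ4 : κ ^ 4 = c := by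
    rw [hκ, ← Real.rpow_natCast, ← Real.rpow_mul hc0.le]
    norm_num
  obtain ⟨C, hC, hmax⟩ := exists_max_image
    {C ∈ A.powerset | (0 : ℝ) ∉ C ∧ (mulEnergy C C : ℝ) ≤ c * (#C : ℝ) ^ 4} card
    ⟨∅, by simp⟩
  rw [mem_filter, mem_powerset] at hC
  obtain ⟨hCA, hC0, hCE⟩ := hC
  refine ⟨C, hCA, hC0, ?_, ?_⟩
  · by_contra! hlt
    obtain ⟨F, hF, hFne, hF0, hFE⟩ := exists_subset_small_mulEnergy (A \ C) #A hA.card_pos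
      (card_le_card sdiff_subset) hlt
    rw [← hc] at hFE
    have hdisj : Disjoint C F := disjoint_of_subset_right hF disjoint_sdiff
    have hcard := card_union_of_disjoint hdisj
    have hFpos := hFne.card_pos
    have hunion : (mulEnergy (C ∪ F) (C ∪ F) : ℝ) ≤ c * (#(C ∪ F) : ℝ) ^ 4 := by
      -- Subadditivity is applied with the weights κ|C| and κ|F|, which must be positive.
      rcases C.eq_empty_or_nonempty with rfl | hCne
      · simpa using hFE
      · have hCpos : (0 : ℝ) < #C := by exact_mod_cast hCne.card_pos
        have hFpos' : (0 : ℝ) < #F := by exact_mod_cast hFpos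
        have h := mulEnergy_union_le C F hC0 hF0 (κ * #C) (κ * #F) (by positivity) (by positivity)
          (by rwa [mul_pow, hκ4]) (by rwa [mul_pow, hκ4])
        rw [← mul_add, mul_pow, hκ4] at h
        rw [hcard]
        push_cast
        exact h
    have := hmax (C ∪ F) (by
      rw [mem_filter, mem_powerset]
      refine ⟨union_subset hCA (hF.trans sdiff_subset), ?_, hunion⟩
      rw [mem_union]
      tauto)
    omega
  · have hCle : (#C : ℝ) ≤ #A := by exact_mod_cast card_le_card hCA
    calc (mulEnergy C C : ℝ) ≤ c * (#C : ℝ) ^ 4 := hCE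
      _ ≤ c * (#A : ℝ) ^ 4 := by gcongr
      _ = 331 * 2 ^ 65 * ((#A : ℝ) ^ (-35 / 33 : ℝ) * (#A : ℝ) ^ 4) := by
          rw [hc]
          ring
      _ = _ := by
          congr 1
          rw [← Real.rpow_natCast, ← Real.rpow_add hN0]
          norm_num

/-- A bound for the energy of order two gives one for the `k`-fold energy. -/
theorem fold_energy_le (N n e f k : ℕ) (hN : 2 ≤ N) (hn : n ≤ N) (K : ℝ)
    (hf : f ≤ n ^ (2 * k) * e) (he : (e : ℝ) ≤ K * (N : ℝ) ^ (3 - 2 / 33 : ℝ)) :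
    (f : ℝ) ≤ 2 * K * (N : ℝ) ^ (2 * ((k + 2 : ℕ) : ℝ) - 1 - 2 / 33) *
      Real.log N ^ ((1 : ℝ) - 2 / 33) := by
  have hN2 : (2 : ℝ) ≤ N := by exact_mod_cast hN
  have hN0 : (0 : ℝ) < N := by linarith
  have hK : 0 ≤ K * (N : ℝ) ^ (3 - 2 / 33 : ℝ) := le_trans (Nat.cast_nonneg _) he
  -- For N ≥ 2 the log factor is at least 1/2, so it can be inserted at the cost of the factor 2 in
  -- `2 * K`.
  have hlog : (1 / 2 : ℝ) ≤ Real.log N ^ ((1 : ℝ) - 2 / 33) := by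
    have h2 : (1 / 2 : ℝ) ≤ Real.log N :=
      le_trans (by linarith [Real.log_two_gt_d9]) (Real.log_le_log (by norm_num) hN2)
    calc (1 / 2 : ℝ) = (1 / 2 : ℝ) ^ (1 : ℝ) := (Real.rpow_one _).symm
      _ ≤ (1 / 2 : ℝ) ^ ((1 : ℝ) - 2 / 33) :=
          Real.rpow_le_rpow_of_exponent_ge (by norm_num) (by norm_num) (by norm_num)
      _ ≤ _ := Real.rpow_le_rpow (by norm_num) h2 (by norm_num)
  have hexp : (N : ℝ) ^ (2 * ((k + 2 : ℕ) : ℝ) - 1 - 2 / 33) =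
      (N : ℝ) ^ (2 * k) * (N : ℝ) ^ (3 - 2 / 33 : ℝ) := by
    rw [← Real.rpow_natCast, ← Real.rpow_add hN0]
    congr 1
    push_cast
    ring
  have hf' : (f : ℝ) ≤ (n : ℝ) ^ (2 * k) * e := by exact_mod_cast hf
  have hnN : (n : ℝ) ≤ N := by exact_mod_cast hn
  calc (f : ℝ) ≤ (n : ℝ) ^ (2 * k) * e := hf'
    _ ≤ (N : ℝ) ^ (2 * k) * (K * (N : ℝ) ^ (3 - 2 / 33 : ℝ)) := by gcongr
    _ = 2 * ((N : ℝ) ^ (2 * k) * (K * (N : ℝ) ^ (3 - 2 / 33 : ℝ))) * (1 / 2) := by ring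
    _ ≤ 2 * ((N : ℝ) ^ (2 * k) * (K * (N : ℝ) ^ (3 - 2 / 33 : ℝ))) *
        Real.log N ^ ((1 : ℝ) - 2 / 33) := by gcongr
    _ = _ := by
        rw [hexp]
        ring

end LowEnergy

theorem theorem1p4 :
    ∃ K : ℝ, 0 < K ∧ ∀ (A : Finset ℝ) (m n : ℕ), 2 ≤ A.card → 2 ≤ m → 2 ≤ n →
      ∃ B C : Finset ℝ, Disjoint B C ∧ A = B ∪ C ∧
        (foldAddEnergy m B : ℝ) ≤
          K * (A.card : ℝ) ^ (2 * (m : ℝ) - 1 - 2 / 33) *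
            Real.log (A.card : ℝ) ^ ((1 : ℝ) - 2 / 33) ∧
        (foldMulEnergy n C : ℝ) ≤
          K * (A.card : ℝ) ^ (2 * (n : ℝ) - 1 - 2 / 33) *
            Real.log (A.card : ℝ) ^ ((1 : ℝ) - 2 / 33) := by
  refine ⟨2 * (331 * 2 ^ 65), by norm_num, fun A m n hA hm hn => ?_⟩
  obtain ⟨m, rfl⟩ := Nat.exists_eq_add_of_le' hm
  obtain ⟨n, rfl⟩ := Nat.exists_eq_add_of_le' hn
  obtain ⟨C, hCA, hC0, hB, hC⟩ := LowEnergy.exists_low_energy_decomposition A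
    (Finset.card_pos.1 (by omega))
  refine ⟨A \ C, C, Finset.sdiff_disjoint, (Finset.sdiff_union_of_subset hCA).symm, ?_, ?_⟩
  · refine LowEnergy.fold_energy_le A.card (A \ C).card _ _ m hA
      (Finset.card_le_card Finset.sdiff_subset) _ (LowEnergy.foldAddEnergy_le (A \ C) m)
      (hB.trans ?_)
    gcongr
    norm_num
  · exact LowEnergy.fold_energy_le A.card C.card _ _ n hA (Finset.card_le_card hCA) _
      (LowEnergy.foldMulEnergy_le C hC0 n) hC
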